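/- Let $H$ be a complex Hilbert space, $\mathcal M\subset B(H)$ a von Neumann algebra, and $a$ a positive self-adjoint (possibly unbounded) operator on $H$ affiliated with $\mathcal M$ whose inverse $a^{-1}$ is a bounded, everywhere defined operator. For an injective positive self-adjoint operator $b$ affiliated with $\mathcal M$ and $x\in\mathcal M$ let $\widehat{b^{1/2}xb^{1/2}}$ be the sesquilinear form $(f,g)\mapsto\langle x\,b^{1/2}f,\,b^{1/2}g\rangle$ on $D(b^{1/2})\times D(b^{1/2})$. Let $$L_\infty(b)=\{\widehat{b^{1/2}xb^{1/2}} : x\in\mathcal M\},\qquad \|\widehat{b^{1/2}xb^{1/2}}\|_b=\|x\| ,$$ (here $x$ is determined by the form), and let $L_\infty^{\mathrm{sa}}(b)$ be the set of those forms with $x=x^*$. On $L_\infty^{\mathrm{sa}}(b)$ consider also the order norm $$p_b(y)=\inf\{\lambda\ge 0 : -\lambda\|b^{1/2}f\|^2\le y(f,f)\le\lambda\|b^{1/2}f\|^2\ \text{ for all } f\in D(b^{1/2})\}.$$ Let $0\le\alpha<\beta$ be real numbers. Then $L_\infty(a^\alpha)\subset L_\infty(a^\beta)$ in the following sense: $D(a^{\beta/2})\subset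 D(a^{\alpha/2})$, the restriction of forms from $D(a^{\alpha/2})$ to $D(a^{\beta/2})$ is injective on $L_\infty(a^\alpha)$, it maps $L_\infty(a^\alpha)$ into $L_\infty(a^\beta)$, and it maps $L_\infty^{\mathrm{sa}}(a^\alpha)$ into $L_\infty^{\mathrm{sa}}(a^\beta)$. Moreover, identifying a form with its restriction, $$\|y\|_{a^\beta}\le\|(a^{-1})^{\beta-\alpha}\|\,\|y\|_{a^\alpha}\quad\text{for all } y\in L_\infty(a^\alpha),$$ $$p_{a^\beta}(y)\le\|(a^{-1})^{\beta-\alpha}\|\,p_{a^\alpha}(y)\quad\text{for all } y\in L_\infty^{\mathrm{sa}}(a^\alpha).$$ In particular $\|\cdot\|_{a^\alpha}\succ\|\cdot\|_{a^\beta}$, that is, $\|y\|_{a^\beta}\le C\|y\|_{a^\alpha}$ on $L_\infty(a^\alpha)$ with a constant $C$. -/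

import Mathlib

noncomputable section

namespace UnboundedOp

open scoped InnerProductSpace

universe u

/-- A densely defined unbounded operator is positive self-adjoint. (Self-adjointness of a
`LinearPMap` includes density of the domain.) -/
structure IsPosSelfAdjoint {H : Type u} [NormedAddCommGroup H] [InnerProductSpace ℂ H]
    [CompleteSpace H] (a : H →ₗ.[ℂ] H) : Prop where
  isSelfAdjoint : IsSelfAdjoint a
  re_inner_nonneg : ∀ f : a.domain, 0 ≤ (⟪(f : H), a f⟫_ℂ).re

/-- `a` is affiliated with `M`: every `T` in the commutant of `M` satisfies `T a ⊆ a T`. -/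
def IsAffiliated {H : Type u} [NormedAddCommGroup H] [InnerProductSpace ℂ H]
    [CompleteSpace H] (M : VonNeumannAlgebra H) (a : H →ₗ.[ℂ] H) : Prop :=
  ∀ T ∈ M.commutant, ∀ f : a.domain, ∃ h : T (f : H) ∈ a.domain, a ⟨T (f : H), h⟩ = T (a f)

/-- The everywhere defined bounded operator `b` is the inverse of the operator `a`. -/
structure IsBoundedInverse {H : Type u} [NormedAddCommGroup H] [InnerProductSpace ℂ H]
    (a : H →ₗ.[ℂ] H) (b : H →L[ℂ] H) : Prop where
  left_inv : ∀ f : a.domain, b (a f) = f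
  right_inv : ∀ g : H, ∃ h : b g ∈ a.domain, a ⟨b g, h⟩ = g

/-- `r` is the bounded inverse of `1 + a`. -/
def IsOneAddInverse {H : Type u} [NormedAddCommGroup H] [InnerProductSpace ℂ H]
    (a : H →ₗ.[ℂ] H) (r : H →L[ℂ] H) : Prop :=
  (∀ f : a.domain, r ((f : H) + a f) = f) ∧
    ∀ g : H, ∃ h : r g ∈ a.domain, r g + a ⟨r g, h⟩ = g

/-- For a positive self-adjoint operator `a` the operator `1 + a` has a bounded everywhere
defined inverse. -/
theorem IsPosSelfAdjoint.exists_isOneAddInverse {H : Type u} [NormedAddCommGroup H]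
    [InnerProductSpace ℂ H] [CompleteSpace H] {a : H →ₗ.[ℂ] H} (ha : IsPosSelfAdjoint a) :
    ∃ r : H →L[ℂ] H, IsOneAddInverse a r := by
  have hcoer : ∀ f : a.domain, ‖(f : H)‖ ≤ ‖(f : H) + a f‖ := by
    intro f
    have h1 : (⟪(f : H), (f : H) + a f⟫_ℂ).re = ‖(f : H)‖ ^ 2 + (⟪(f : H), a f⟫_ℂ).re := by
      rw [inner_add_right, Complex.add_re]
      congr 1
      exact (norm_sq_eq_re_inner (𝕜 := ℂ) (f : H)).symm
    have h2 : (⟪(f : H), (f : H) + a f⟫_ℂ).re ≤ ‖(f : H)‖ * ‖(f : H) + a f‖ :=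
      (Complex.re_le_norm _).trans (norm_inner_le_norm _ _)
    have h3 := ha.re_inner_nonneg f
    by_contra hlt
    push Not at hlt
    nlinarith [norm_nonneg ((f : H) + a f), norm_nonneg (f : H)]
  let S : a.domain →ₗ[ℂ] H := a.domain.subtype + a.toFun
  have hS : ∀ f : a.domain, S f = (f : H) + a f := fun f => rfl
  have hinj : Function.Injective S := by
    rw [← LinearMap.ker_eq_bot, LinearMap.ker_eq_bot']
    intro f hf
    have := hcoer f
    rw [← hS, hf, norm_zero] at this
    exact Subtype.ext (norm_le_zero_iff.mp this)
  have hdense := ha.isSelfAdjoint.dense_domain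
  have hadj : a.adjoint = a := ha.isSelfAdjoint
  have hclosed : IsClosed (LinearMap.range S : Set H) := by
    rw [← isSeqClosed_iff_isClosed]
    intro u g hu hg
    choose f hf using hu
    have hfc : CauchySeq (fun n => ((f n : a.domain) : H)) := by
      rw [Metric.cauchySeq_iff']
      intro ε hε
      obtain ⟨N, hN⟩ := Metric.cauchySeq_iff'.mp hg.cauchySeq ε hε
      refine ⟨N, fun n hn => lt_of_le_of_lt ?_ (hN n hn)⟩
      rw [dist_eq_norm, dist_eq_norm, ← hf n, ← hf N, ← map_sub, hS]
      exact hcoer (f n - f N)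
    obtain ⟨w, hw⟩ := cauchySeq_tendsto_of_complete hfc
    have haf : Filter.Tendsto (fun n => a (f n)) Filter.atTop (nhds (g - w)) := by
      have : (fun n => a (f n)) = fun n => u n - (f n : H) := by
        funext n
        rw [← hf n, hS]
        abel
      rw [this]
      exact hg.sub hw
    have hmem : (w, g - w) ∈ a.graph :=
      ha.isSelfAdjoint.isClosed.mem_of_tendsto (hw.prodMk_nhds haf)
        (Filter.Eventually.of_forall fun n => a.mem_graph (f n))
    rw [LinearPMap.mem_graph_iff] at hmem
    obtain ⟨f', h1, h2⟩ := hmem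
    simp only at h1 h2
    exact ⟨f', by rw [hS, h1, h2]; abel⟩
  have htop : LinearMap.range S = ⊤ := by
    have : CompleteSpace (LinearMap.range S) := hclosed.completeSpace_coe
    rw [← Submodule.orthogonal_eq_bot_iff, Submodule.eq_bot_iff]
    intro y hy
    have hy' : ∀ f : a.domain, ⟪-y, (f : H)⟫_ℂ = ⟪y, a f⟫_ℂ := by
      intro f
      have := Submodule.inner_left_of_mem_orthogonal (LinearMap.mem_range_self S f) hy
      rw [hS, inner_add_right] at this
      rw [inner_neg_left]
      linear_combination -this
    have hyd : y ∈ a.adjoint.domain := LinearPMap.mem_adjoint_domain_of_exists y ⟨-y, hy'⟩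
    have hya : a.adjoint ⟨y, hyd⟩ = -y := LinearPMap.adjoint_apply_eq hdense _ hy'
    have hyd' : y ∈ a.domain := hadj ▸ hyd
    have hya' : a ⟨y, hyd'⟩ = -y := by
      rw [← hya]
      exact (LinearPMap.ext_iff.mp hadj.symm).2 (x := y) (hf := hyd') (hg := hyd)
    have := hcoer ⟨y, hyd'⟩
    rw [hya'] at this
    simpa using this
  let e : a.domain ≃ₗ[ℂ] H := LinearEquiv.ofBijective S ⟨hinj, LinearMap.range_eq_top.mp htop⟩
  have he : ∀ f : a.domain, e f = (f : H) + a f := fun f => rfl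
  refine ⟨(a.domain.subtype ∘ₗ (e.symm : H →ₗ[ℂ] a.domain)).mkContinuous 1 fun g => ?_,
    fun f => ?_, fun g => ⟨(e.symm g).2, ?_⟩⟩
  · have := hcoer (e.symm g)
    rw [← he, e.apply_symm_apply] at this
    simpa using this
  · rw [← he]
    simp
  · have := he (e.symm g)
    rw [e.apply_symm_apply] at this
    exact this.symm

open scoped Classical in
/-- The bounded operator `(1 + a)⁻¹` (which exists for every positive self-adjoint `a`). -/
def oneAddInverse {H : Type u} [NormedAddCommGroup H] [InnerProductSpace ℂ H]
    (a : H →ₗ.[ℂ] H) : H →L[ℂ] H :=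
  if h : ∃ r : H →L[ℂ] H, IsOneAddInverse a r then h.choose else 0

/-- The power `a ^ s`, `0 ≤ s`, of a positive self-adjoint operator `a`, possibly unbounded.

With `r = (1 + a)⁻¹`, a positive injective contraction, one has `a = (1 - r) r⁻¹`, and the Borel
functional calculus gives `a ^ s = ((1 - r) / r) ^ s`. As `(1 - t) ^ s` is bounded on `[0, 1]` and
equals one at `t = 0`, this is the operator `(1 - r) ^ s (r ^ s)⁻¹` on its natural domain, the
range of `r ^ s`; the two powers on the right are those of bounded positive operators. -/
def opPow {H : Type u} [NormedAddCommGroup H] [InnerProductSpace ℂ H] [CompleteSpace H]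
    (a : H →ₗ.[ℂ] H) (s : ℝ) : H →ₗ.[ℂ] H :=
  ((((1 : H →L[ℂ] H) - oneAddInverse a) ^ s : H →L[ℂ] H) : H →ₗ[ℂ] H).compPMap
    ((((oneAddInverse a) ^ s : H →L[ℂ] H) : H →ₗ[ℂ] H).toPMap ⊤).inverse

/-- The positive square root `a ^ (1 / 2)`. -/
def opSqrt {H : Type u} [NormedAddCommGroup H] [InnerProductSpace ℂ H] [CompleteSpace H]
    (a : H →ₗ.[ℂ] H) : H →ₗ.[ℂ] H :=
  opPow a (1 / 2)

/-- Sesquilinear forms on a subspace, linear in the first and conjugate-linear in the second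
variable. -/
abbrev SesqForm {H : Type u} [NormedAddCommGroup H] [InnerProductSpace ℂ H]
    (D : Submodule ℂ H) : Type u :=
  D →ₗ[ℂ] D →ₗ⋆[ℂ] ℂ

/-- Restriction of a sesquilinear form to a smaller subspace. -/
def SesqForm.restrict {H : Type u} [NormedAddCommGroup H] [InnerProductSpace ℂ H]
    {D₁ D₂ : Submodule ℂ H} (h : D₁ ≤ D₂) (y : SesqForm D₂) : SesqForm D₁ :=
  LinearMap.mk₂'ₛₗ (RingHom.id ℂ) (starRingEnd ℂ)
    (fun f g => y (Submodule.inclusion h f) (Submodule.inclusion h g))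
    (fun f₁ f₂ g => by simp) (fun c f g => by simp)
    (fun f g₁ g₂ => by simp) (fun c f g => by simp)

/-- The linear map that sends a bounded operator `x` to the sesquilinear form
`(f, g) ↦ ⟨x a^{1/2} f, a^{1/2} g⟩` on `D(a^{1/2})`, where `⟨·, ·⟩` is linear in its first
variable (Mathlib's inner product is linear in the second one). -/
def form {H : Type u} [NormedAddCommGroup H] [InnerProductSpace ℂ H] [CompleteSpace H]
    (a : H →ₗ.[ℂ] H) : (H →L[ℂ] H) →ₗ[ℂ] SesqForm (opSqrt a).domain where
  toFun x := LinearMap.mk₂'ₛₗ (RingHom.id ℂ) (starRingEnd ℂ)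
    (fun f g => ⟪opSqrt a g, x (opSqrt a f)⟫_ℂ)
    (fun f₁ f₂ g => by simp [LinearPMap.map_add])
    (fun c f g => by simp [LinearPMap.map_smul])
    (fun f g₁ g₂ => by simp [LinearPMap.map_add])
    (fun c f g => by simp [LinearPMap.map_smul, mul_comm])
  map_add' x₁ x₂ := by
    ext f g
    simp
  map_smul' c x := by
    ext f g
    simp

theorem form_apply {H : Type u} [NormedAddCommGroup H] [InnerProductSpace ℂ H] [CompleteSpace H]
    (a : H →ₗ.[ℂ] H) (x : H →L[ℂ] H) (f g : (opSqrt a).domain) :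
    form a x f g = ⟪opSqrt a g, x (opSqrt a f)⟫_ℂ := rfl

/-- The space `L_∞(a)`, realised as the space of the sesquilinear forms `a^{1/2} x a^{1/2}` on
`D(a^{1/2})` with `x ∈ M`. -/
def Linfty {H : Type u} [NormedAddCommGroup H] [InnerProductSpace ℂ H] [CompleteSpace H]
    (M : VonNeumannAlgebra H) (a : H →ₗ.[ℂ] H) : Submodule ℂ (SesqForm (opSqrt a).domain) :=
  (Subalgebra.toSubmodule M.toStarSubalgebra.toSubalgebra).map (form a)

/-- The norm of `L_∞(a)`, `a` injective, for which `x ↦ a^{1/2} x a^{1/2}` is an isometry of `M`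
onto `L_∞(a)`: the norm of `y` is the norm of the (unique) `x ∈ M` that represents `y`. -/
def linftyNorm {H : Type u} [NormedAddCommGroup H] [InnerProductSpace ℂ H] [CompleteSpace H]
    (M : VonNeumannAlgebra H) (a : H →ₗ.[ℂ] H) (y : SesqForm (opSqrt a).domain) : ℝ :=
  sInf {c : ℝ | ∃ x ∈ M, form a x = y ∧ ‖x‖ = c}

/-- The self-adjoint part of `L_∞(a)`: the forms `a^{1/2} x a^{1/2}` with `x ∈ M` self-adjoint. -/
def LinftySA {H : Type u} [NormedAddCommGroup H] [InnerProductSpace ℂ H] [CompleteSpace H]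
    (M : VonNeumannAlgebra H) (a : H →ₗ.[ℂ] H) : Set (SesqForm (opSqrt a).domain) :=
  {y | ∃ x ∈ M, IsSelfAdjoint x ∧ form a x = y}

/-- The order of Hermitian forms: `y ≤ z` iff `y(f, f) ≤ z(f, f)` for all `f` (the values are
real for Hermitian forms). -/
def FormLE {H : Type u} [NormedAddCommGroup H] [InnerProductSpace ℂ H]
    {D : Submodule ℂ H} (y z : SesqForm D) : Prop :=
  ∀ f : D, (y f f).re ≤ (z f f).re

/-- The order norm `inf {t ≥ 0 | -t a ≤ y ≤ t a}` of a Hermitian form `y`, where `a` stands for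
the form `a^{1/2} 1 a^{1/2}`. -/
def orderNorm {H : Type u} [NormedAddCommGroup H] [InnerProductSpace ℂ H] [CompleteSpace H]
    (a : H →ₗ.[ℂ] H) (y : SesqForm (opSqrt a).domain) : ℝ :=
  sInf {t : ℝ | 0 ≤ t ∧ FormLE (-((t : ℂ) • form a 1)) y ∧ FormLE y ((t : ℂ) • form a 1)}

end UnboundedOp

end

open UnboundedOp

/-! Write `b` for the bounded inverse of `a`; it is positive, injective and lies in `M`. Put `c = b
^ ((β - α) / 2)`. On `D(a^{β/2})` one has `a^{α/2} = c a^{β/2}`, so the form of `x` at `a^α`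
restricts to the form of `c x c` at `a^β`. Since `c ∈ M` is self-adjoint, `c x c` stays in `M` and
self-adjointness of `x` is kept; since `c` is injective, `c x c` determines `x`. Both norm bounds
come from `‖c‖² = ‖b ^ (β - α)‖`.

The unbounded calculus enters only through `IsBoundedInverse.opPow`: `a^s` has bounded inverse
`b^s`. Domains and values of the powers of `a` are then read off from identities between bounded
powers of `b`. -/

namespace UnboundedOp

open scoped InnerProductSpace NNReal

section BoundedInverse

variable {H : Type*} [NormedAddCommGroup H] [InnerProductSpace ℂ H]

theorem IsBoundedInverse.injective {a : H →ₗ.[ℂ] H} {b : H →L[ℂ] H}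
    (h : IsBoundedInverse a b) : Function.Injective b := by
  intro f g hfg
  obtain ⟨hf, hf'⟩ := h.right_inv f
  obtain ⟨hg, hg'⟩ := h.right_inv g
  rw [← hf', ← hg']
  congr 1
  exact Subtype.ext hfg

theorem IsBoundedInverse.exists_apply_eq {a : H →ₗ.[ℂ] H} {b : H →L[ℂ] H}
    (h : IsBoundedInverse a b) (g : H) : ∃ f : a.domain, a f = g :=
  ⟨⟨b g, (h.right_inv g).1⟩, (h.right_inv g).2⟩

theorem IsOneAddInverse.unique {a : H →ₗ.[ℂ] H} {r r' : H →L[ℂ] H}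
    (h : IsOneAddInverse a r) (h' : IsOneAddInverse a r') : r = r' := by
  ext g
  obtain ⟨hd, hg⟩ := h'.2 g
  have := h.1 ⟨r' g, hd⟩
  rwa [hg] at this

theorem IsOneAddInverse.oneAddInverse_eq [CompleteSpace H] {a : H →ₗ.[ℂ] H} {r : H →L[ℂ] H}
    (h : IsOneAddInverse a r) : oneAddInverse a = r := by
  have hex : ∃ r : H →L[ℂ] H, IsOneAddInverse a r := ⟨r, h⟩
  rw [oneAddInverse, dif_pos hex]
  exact hex.choose_spec.unique h

/-- If `b` is the bounded inverse of `a`, then `(1 + a)⁻¹ = b (1 + b)⁻¹`. -/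
theorem IsBoundedInverse.isOneAddInverse {a : H →ₗ.[ℂ] H} {b p : H →L[ℂ] H}
    (h : IsBoundedInverse a b) (hp : p + b * p = 1) (hp' : p + p * b = 1) :
    IsOneAddInverse a (1 - p) := by
  have h1 : 1 - p = b * p := by rw [← hp]; abel
  refine ⟨fun f => ?_, fun g => ?_⟩
  · have h2 : (1 - p) * (b + 1) = b := by
      rw [sub_mul, one_mul, mul_add, mul_one, add_comm (p * b), hp']; abel
    have h3 := congrArg (fun T : H →L[ℂ] H => T (a f)) h2
    simp only [mul_apply_eq_comp, add_apply,
      one_apply_eq_self, h.left_inv] at h3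
    exact h3
  · rw [h1]
    obtain ⟨hd, hg⟩ := h.right_inv (p g)
    refine ⟨hd, ?_⟩
    have h3 := congrArg (fun T : H →L[ℂ] H => T g) hp
    simp only [mul_apply_eq_comp, add_apply,
      one_apply_eq_self] at h3
    rw [add_comm] at h3
    refine Eq.trans ?_ h3
    congr 1

variable [CompleteSpace H]

theorem IsBoundedInverse.nonneg {a : H →ₗ.[ℂ] H} {b : H →L[ℂ] H}
    (h : IsBoundedInverse a b) (ha : IsPosSelfAdjoint a) : 0 ≤ b := by
  have hsymm : ∀ f g : a.domain, ⟪a f, (g : H)⟫_ℂ = ⟪(f : H), a g⟫_ℂ := by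
    have := LinearPMap.adjoint_isFormalAdjoint ha.isSelfAdjoint.dense_domain
    rw [show a.adjoint = a from ha.isSelfAdjoint] at this
    exact this
  rw [ContinuousLinearMap.nonneg_iff_isPositive]
  refine ⟨fun f g => ?_, fun g => ?_⟩
  · obtain ⟨hf, hf'⟩ := h.right_inv f
    obtain ⟨hg, hg'⟩ := h.right_inv g
    have := hsymm ⟨b f, hf⟩ ⟨b g, hg⟩
    rw [hf', hg'] at this
    exact this.symm
  · obtain ⟨hg, hg'⟩ := h.right_inv g
    have := ha.re_inner_nonneg ⟨b g, hg⟩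
    rw [hg'] at this
    exact this

/-- By the double commutant theorem it suffices that `b` commutes with each `T` in the commutant.
Affiliation at `b g` gives `a (T (b g)) = T g`; apply `b`. -/
theorem IsBoundedInverse.mem_of_isAffiliated {M : VonNeumannAlgebra H} {a : H →ₗ.[ℂ] H}
    {b : H →L[ℂ] H} (h : IsBoundedInverse a b) (ha : IsAffiliated M a) : b ∈ M := by
  rw [← M.commutant_commutant, VonNeumannAlgebra.mem_commutant_iff]
  intro T hT
  ext g
  obtain ⟨hg, hg'⟩ := h.right_inv g
  obtain ⟨hT1, hT2⟩ := ha T hT ⟨b g, hg⟩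
  rw [hg'] at hT2
  have := h.left_inv ⟨T (b g), hT1⟩
  rw [hT2] at this
  exact this.symm

end BoundedInverse

/-! ### Powers of `a` and of its bounded inverse -/

section Powers

variable {H : Type*} [NormedAddCommGroup H] [InnerProductSpace ℂ H] [CompleteSpace H]

theorem rpow_mem_vonNeumannAlgebra {M : VonNeumannAlgebra H} {b : H →L[ℂ] H} (hb : b ∈ M)
    (s : ℝ) : b ^ s ∈ M := by
  rw [← M.commutant_commutant, VonNeumannAlgebra.mem_commutant_iff]
  intro T hT
  have hc : Commute b T := VonNeumannAlgebra.mem_commutant_iff.mp hT b hb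
  exact (hc.cfc_nnreal _).symm

/-- Nonnegative exponents keep the power functions continuous at `0`, so `0` may lie in the spectrum
of `b`. -/
theorem rpow_add_of_nonneg {b : H →L[ℂ] H} {s t : ℝ} (hs : 0 ≤ s) (ht : 0 ≤ t) :
    b ^ (s + t) = b ^ s * b ^ t := by
  simp only [CFC.rpow_def]
  rw [← cfc_mul (fun x : ℝ≥0 => x ^ s) (fun x : ℝ≥0 => x ^ t) b
    (NNReal.continuous_rpow_const hs).continuousOn (NNReal.continuous_rpow_const ht).continuousOn]
  exact cfc_congr fun x _ => NNReal.rpow_add_of_nonneg x hs ht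

/-- For an integer `n ≥ s`, `b ^ s` is a right factor of the injective operator `b ^ n`. -/
theorem rpow_injective {b : H →L[ℂ] H} (hb : 0 ≤ b) (hinj : Function.Injective b) {s : ℝ}
    (hs : 0 ≤ s) : Function.Injective (b ^ s : H →L[ℂ] H) := by
  obtain ⟨n, hn⟩ := exists_nat_ge s
  have h : b ^ n = b ^ ((n : ℝ) - s) * b ^ s := by
    rw [← rpow_add_of_nonneg (sub_nonneg.mpr hn) hs, sub_add_cancel, CFC.rpow_natCast b n hb]
  have hn' : Function.Injective (b ^ n : H →L[ℂ] H) := by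
    rw [FunLike.coe_pow_eq_iterate]
    exact hinj.iterate n
  rw [h] at hn'
  exact Function.Injective.of_comp (f := (b ^ ((n : ℝ) - s) : H →L[ℂ] H)) hn'

theorem opPow_apply_eq {a : H →ₗ.[ℂ] H} {s : ℝ}
    (hinj : Function.Injective ((oneAddInverse a) ^ s : H →L[ℂ] H))
    (f : (opPow a s).domain) (g : H) (hg : ((oneAddInverse a) ^ s : H →L[ℂ] H) g = f) :
    opPow a s f = ((1 - oneAddInverse a) ^ s : H →L[ℂ] H) g := by
  have hker : LinearMap.ker
      ((((oneAddInverse a) ^ s : H →L[ℂ] H) : H →ₗ[ℂ] H).toPMap ⊤).toFun = ⊥ := by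
    rw [LinearMap.ker_eq_bot]
    intro u v huv
    exact Subtype.ext (hinj huv)
  exact congrArg ((1 - oneAddInverse a) ^ s : H →L[ℂ] H)
    (LinearPMap.inverse_apply_eq hker (y := f) (x := ⟨g, trivial⟩) hg)

theorem mem_opPow_domain {a : H →ₗ.[ℂ] H} {s : ℝ} {f : H} :
    f ∈ (opPow a s).domain ↔ ∃ g, ((oneAddInverse a) ^ s : H →L[ℂ] H) g = f := by
  change f ∈ ((((oneAddInverse a) ^ s : H →L[ℂ] H) : H →ₗ[ℂ] H).toPMap ⊤).inverse.domain ↔ _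
  rw [LinearPMap.inverse_domain]
  exact ⟨fun ⟨u, hu⟩ => ⟨u, hu⟩, fun ⟨u, hu⟩ => ⟨⟨u, trivial⟩, hu⟩⟩

/-- The powers of a boundedly invertible operator are the inverses of the powers of its inverse. -/
theorem IsBoundedInverse.opPow {a : H →ₗ.[ℂ] H} {b : H →L[ℂ] H} (h : IsBoundedInverse a b)
    (hb : 0 ≤ b) {s : ℝ} (hs : 0 ≤ s) : IsBoundedInverse (opPow a s) (b ^ s) := by
  have hcψ : Continuous fun t : ℝ≥0 => (1 + t)⁻¹ :=
    Continuous.inv₀ (by fun_prop) fun t => (add_pos_of_pos_of_nonneg one_pos zero_le).ne'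
  have hcφ : Continuous fun t : ℝ≥0 => t * (1 + t)⁻¹ := continuous_id.mul hcψ
  have hcs : Continuous fun t : ℝ≥0 => t ^ s := NNReal.continuous_rpow_const hs
  -- Here `p = (1 + b)⁻¹`, and `q = b p` turns out to be `(1 + a)⁻¹`. Thus `opPow a s` is `p^s
  -- (q^s)⁻¹`, and `q^s = b^s p^s` with `p^s` invertible reduces it to `(b^s)⁻¹`.
  set p : H →L[ℂ] H := cfc (fun t : ℝ≥0 => (1 + t)⁻¹) b with hp
  set q : H →L[ℂ] H := cfc (fun t : ℝ≥0 => t * (1 + t)⁻¹) b with hq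
  have hbp : b * p = q := by
    conv_lhs => rw [← cfc_id' ℝ≥0 b hb]
    rw [hp, hq, cfc_mul (fun t : ℝ≥0 => t) _ b continuous_id.continuousOn hcψ.continuousOn]
  have hcomm : p * b = b * p :=
    ((Commute.refl b).cfc_nnreal _).eq
  have hpq : p + q = 1 := by
    rw [hp, hq, ← cfc_add b _ _ hcψ.continuousOn hcφ.continuousOn, ← cfc_const_one ℝ≥0 b]
    refine cfc_congr fun t _ => ?_
    have : (1 + t : ℝ≥0) ≠ 0 := by positivity
    field_simp
  have hr : oneAddInverse a = q := by
    rw [(h.isOneAddInverse (by rw [hbp, hpq]) (by rw [hcomm, hbp, hpq])).oneAddInverse_eq, ← hpq]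
    abel
  have hr' : 1 - oneAddInverse a = p := by rw [hr, ← hpq]; abel
  have hps : p ^ s = cfc (fun t : ℝ≥0 => ((1 + t)⁻¹) ^ s) b := by
    rw [CFC.rpow_def, hp, ← cfc_comp' (fun t : ℝ≥0 => t ^ s) _ b hcs.continuousOn hcψ.continuousOn]
  have hqs : q ^ s = b ^ s * p ^ s := by
    rw [hps, CFC.rpow_def, CFC.rpow_def, hq,
      ← cfc_comp' (fun t : ℝ≥0 => t ^ s) _ b hcs.continuousOn hcφ.continuousOn,
      ← cfc_mul _ _ b hcs.continuousOn (hcs.comp' hcψ).continuousOn]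
    exact cfc_congr fun t _ => NNReal.mul_rpow
  obtain ⟨w, hpw, hwp⟩ : ∃ w : H →L[ℂ] H, p ^ s * w = 1 ∧ w * p ^ s = 1 := by
    have hcw : Continuous fun t : ℝ≥0 => (1 + t) ^ s :=
      hcs.comp (continuous_const.add continuous_id)
    have hcp : Continuous fun t : ℝ≥0 => ((1 + t)⁻¹) ^ s := hcs.comp hcψ
    refine ⟨cfc (fun t : ℝ≥0 => (1 + t) ^ s) b, ?_, ?_⟩
    · rw [hps, ← cfc_mul _ _ b hcp.continuousOn hcw.continuousOn, ← cfc_const_one ℝ≥0 b]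
      refine cfc_congr fun t _ => ?_
      have : (1 + t : ℝ≥0) ≠ 0 := by positivity
      rw [← NNReal.mul_rpow]
      simp [this]
    · rw [hps, ← cfc_mul _ _ b hcw.continuousOn hcp.continuousOn, ← cfc_const_one ℝ≥0 b]
      refine cfc_congr fun t _ => ?_
      have : (1 + t : ℝ≥0) ≠ 0 := by positivity
      rw [← NNReal.mul_rpow]
      simp [this]
  have hinj : Function.Injective (q ^ s : H →L[ℂ] H) := by
    rw [hqs]
    refine (rpow_injective hb h.injective hs).comp (Function.LeftInverse.injective (g := w) ?_)
    exact fun g => congrArg (fun T : H →L[ℂ] H => T g) hwp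
  have happly : ∀ (f : (UnboundedOp.opPow a s).domain) (g : H), (q ^ s : H →L[ℂ] H) g = f →
      UnboundedOp.opPow a s f = (p ^ s : H →L[ℂ] H) g := by
    intro f g hg
    rw [← hr']
    exact opPow_apply_eq (by rwa [hr]) f g (by rwa [hr])
  refine ⟨fun f => ?_, fun g => ?_⟩
  · obtain ⟨g, hg⟩ := mem_opPow_domain.mp f.2
    rw [hr] at hg
    rw [happly f g hg, ← hg, hqs]
    rfl
  · have hg : (q ^ s : H →L[ℂ] H) (w g) = (b ^ s : H →L[ℂ] H) g := by
      rw [hqs]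
      change (b ^ s * p ^ s * w : H →L[ℂ] H) g = _
      rw [mul_assoc, hpw, mul_one]
    have hd : (b ^ s : H →L[ℂ] H) g ∈ (UnboundedOp.opPow a s).domain :=
      mem_opPow_domain.mpr ⟨w g, by rw [hr, hg]⟩
    refine ⟨hd, ?_⟩
    rw [happly ⟨_, hd⟩ (w g) hg]
    exact congrArg (fun T : H →L[ℂ] H => T g) hpw

/-- `IsBoundedInverse.opPow` asks only for a positive bounded inverse, so it can be applied again to
`a^s` itself. -/
theorem IsBoundedInverse.opSqrt_opPow {a : H →ₗ.[ℂ] H} {b : H →L[ℂ] H} (h : IsBoundedInverse a b)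
    (hb : 0 ≤ b) {s : ℝ} (hs : 0 ≤ s) :
    IsBoundedInverse (opSqrt (UnboundedOp.opPow a s)) (b ^ (s / 2)) := by
  have := (h.opPow hb hs).opPow CFC.rpow_nonneg (s := 1 / 2) (by norm_num)
  rwa [CFC.rpow_rpow_of_exponent_nonneg b s (1 / 2) hs (by norm_num) hb, mul_one_div] at this

end Powers

/-! ### Forms, their norms and restriction -/

section Forms

variable {H : Type*} [NormedAddCommGroup H] [InnerProductSpace ℂ H]

theorem restrict_apply {D₁ D₂ : Submodule ℂ H} (h : D₁ ≤ D₂) (y : SesqForm D₂) (f g : D₁) :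
    SesqForm.restrict h y f g = y (Submodule.inclusion h f) (Submodule.inclusion h g) := rfl

variable [CompleteSpace H]

theorem mem_linfty_iff {M : VonNeumannAlgebra H} {a : H →ₗ.[ℂ] H}
    {y : SesqForm (opSqrt a).domain} : y ∈ Linfty M a ↔ ∃ x ∈ M, form a x = y := Iff.rfl

/-- Injectivity cancels `c` only on the left; taking adjoints moves the right factor there. -/
theorem eq_of_conj_eq {c x x' : H →L[ℂ] H} (hc : IsSelfAdjoint c) (hinj : Function.Injective c)
    (h : c * x * c = c * x' * c) : x = x' := by
  have hcancel : ∀ u v : H →L[ℂ] H, c * u = c * v → u = v := by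
    intro u v huv
    ext g
    apply hinj
    rw [← mul_apply_eq_comp, ← mul_apply_eq_comp, huv]
  have h1 : x * c = x' * c := hcancel _ _ (by rwa [← mul_assoc, ← mul_assoc])
  have h2 : c * star x = c * star x' := by
    simpa [hc.star_eq] using congrArg star h1
  exact star_injective (hcancel _ _ h2)

theorem form_injective {a : H →ₗ.[ℂ] H} (ha : ∀ g, ∃ f, opSqrt a f = g) :
    Function.Injective (form a) := by
  intro x x' hxx
  ext u
  refine ext_inner_left ℂ fun v => ?_
  obtain ⟨f, rfl⟩ := ha u
  obtain ⟨g, rfl⟩ := ha v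
  rw [← form_apply, ← form_apply, hxx]

theorem linftyNorm_form {M : VonNeumannAlgebra H} {a : H →ₗ.[ℂ] H}
    (ha : Function.Injective (form a)) {x : H →L[ℂ] H} (hx : x ∈ M) :
    linftyNorm M a (form a x) = ‖x‖ := by
  have : {c : ℝ | ∃ x' ∈ M, form a x' = form a x ∧ ‖x'‖ = c} = {‖x‖} := by
    ext c
    refine ⟨?_, fun hc => ⟨x, hx, rfl, hc.symm⟩⟩
    rintro ⟨x', -, hx', rfl⟩
    rw [ha hx', Set.mem_singleton_iff]
  rw [linftyNorm, this, csInf_singleton]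

theorem re_form_one (a : H →ₗ.[ℂ] H) (t : ℝ) (f : (opSqrt a).domain) :
    (((t : ℂ) • form a 1) f f).re = t * ‖opSqrt a f‖ ^ 2 := by
  simp only [LinearMap.smul_apply, form_apply, one_apply_eq_self, smul_eq_mul,
    Complex.re_ofReal_mul]
  rw [inner_self_eq_norm_sq_to_K]
  norm_cast

/-- The set over which the infimum in the order norm is taken. -/
theorem orderNorm_set_eq (a : H →ₗ.[ℂ] H) (y : SesqForm (opSqrt a).domain) :
    {t : ℝ | 0 ≤ t ∧ FormLE (-((t : ℂ) • form a 1)) y ∧ FormLE y ((t : ℂ) • form a 1)} =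
      {t : ℝ | 0 ≤ t ∧ ∀ f, |(y f f).re| ≤ t * ‖opSqrt a f‖ ^ 2} := by
  ext t
  simp only [FormLE, Set.mem_ofPred_eq, abs_le, ← forall_and]
  refine and_congr_right fun _ => forall_congr' fun f => ?_
  rw [LinearMap.neg_apply, LinearMap.neg_apply, Complex.neg_re, re_form_one]

theorem restrict_form {a a' : H →ₗ.[ℂ] H} (hD : (opSqrt a').domain ≤ (opSqrt a).domain)
    {c : H →L[ℂ] H} (hc : IsSelfAdjoint c)
    (h : ∀ f, opSqrt a (Submodule.inclusion hD f) = c (opSqrt a' f)) (x : H →L[ℂ] H) :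
    SesqForm.restrict hD (form a x) = form a' (c * x * c) := by
  ext f g
  rw [restrict_apply, form_apply, form_apply, h, h]
  exact hc.isSymmetric _ _

theorem orderNorm_restrict_le {a a' : H →ₗ.[ℂ] H}
    (hD : (opSqrt a').domain ≤ (opSqrt a).domain) {c : H →L[ℂ] H}
    (h : ∀ f, opSqrt a (Submodule.inclusion hD f) = c (opSqrt a' f)) (x : H →L[ℂ] H) :
    orderNorm a' (SesqForm.restrict hD (form a x)) ≤ ‖c‖ ^ 2 * orderNorm a (form a x) := by
  rw [orderNorm, orderNorm, orderNorm_set_eq, orderNorm_set_eq, ← smul_eq_mul,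
    ← Real.sInf_smul_of_nonneg (sq_nonneg ‖c‖)]
  -- Multiplication by `‖c‖²` sends bounds admissible for `a` to bounds admissible for `a'`. The
  -- witness `‖x‖` is needed because the real `sInf` of the empty set is `0`.
  refine csInf_le_csInf ⟨0, fun t ht => ht.1⟩ (Set.Nonempty.smul_set ⟨‖x‖, norm_nonneg x, ?_⟩) ?_
  · intro f
    rw [form_apply]
    calc _ ≤ ‖⟪opSqrt a f, x (opSqrt a f)⟫_ℂ‖ := Complex.abs_re_le_norm _
      _ ≤ ‖opSqrt a f‖ * ‖x (opSqrt a f)‖ := norm_inner_le_norm _ _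
      _ ≤ ‖opSqrt a f‖ * (‖x‖ * ‖opSqrt a f‖) := by gcongr; exact x.le_opNorm _
      _ = ‖x‖ * ‖opSqrt a f‖ ^ 2 := by ring
  · rintro _ ⟨t, ⟨ht0, ht⟩, rfl⟩
    refine ⟨mul_nonneg (sq_nonneg _) ht0, fun f => ?_⟩
    rw [restrict_apply]
    change _ ≤ ‖c‖ ^ 2 * t * ‖opSqrt a' f‖ ^ 2
    calc _ ≤ t * ‖opSqrt a (Submodule.inclusion hD f)‖ ^ 2 := ht (Submodule.inclusion hD f)
      _ ≤ t * (‖c‖ * ‖opSqrt a' f‖) ^ 2 := by rw [h]; gcongr; exact c.le_opNorm _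
      _ = _ := by ring

end Forms

end UnboundedOp

open UnboundedOp
theorem mainTheorem7 {H : Type*} [NormedAddCommGroup H] [InnerProductSpace ℂ H] [CompleteSpace H]
    (M : VonNeumannAlgebra H) (a : H →ₗ.[ℂ] H) (ha : IsPosSelfAdjoint a)
    (haM : IsAffiliated M a) (ainv : H →L[ℂ] H) (hinv : IsBoundedInverse a ainv)
    (α β : ℝ) (hα : 0 ≤ α) (hαβ : α < β) :
    ∃ hD : (opSqrt (opPow a β)).domain ≤
        (opSqrt (opPow a α)).domain,
      Set.InjOn (SesqForm.restrict hD) (Linfty M (opPow a α)) ∧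
      (∀ y ∈ Linfty M (opPow a α),
        SesqForm.restrict hD y ∈ Linfty M (opPow a β) ∧
        linftyNorm M (opPow a β) (SesqForm.restrict hD y) ≤
          ‖(ainv ^ (β - α) : H →L[ℂ] H)‖ * linftyNorm M (opPow a α) y) ∧
      (∀ y ∈ LinftySA M (opPow a α),
        SesqForm.restrict hD y ∈ LinftySA M (opPow a β) ∧
        orderNorm (opPow a β) (SesqForm.restrict hD y) ≤
          ‖(ainv ^ (β - α) : H →L[ℂ] H)‖ * orderNorm (opPow a α) y) := by
  have hb := hinv.nonneg ha
  have hγ : 0 ≤ (β - α) / 2 := by linarith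
  have hiα := hinv.opSqrt_opPow hb hα
  have hiβ := hinv.opSqrt_opPow hb (hα.trans hαβ.le)
  set c : H →L[ℂ] H := ainv ^ ((β - α) / 2) with hc
  have hcM : c ∈ M := rpow_mem_vonNeumannAlgebra (hinv.mem_of_isAffiliated haM) _
  have hcsa : IsSelfAdjoint c := IsSelfAdjoint.of_nonneg CFC.rpow_nonneg
  have hcinj : Function.Injective c := rpow_injective hb hinv.injective hγ
  have hnorm : ‖(ainv ^ (β - α) : H →L[ℂ] H)‖ = ‖c‖ ^ 2 := by
    rw [← add_halves (β - α), rpow_add_of_nonneg hγ hγ, ← hc, sq, ← CStarRing.norm_star_mul_self,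
      hcsa.star_eq]
  have hfac : ∀ g, (ainv ^ (α / 2) : H →L[ℂ] H) (c g) = (ainv ^ (β / 2) : H →L[ℂ] H) g := by
    intro g
    rw [show β / 2 = α / 2 + (β - α) / 2 by ring, rpow_add_of_nonneg (by linarith) hγ, mul_apply_eq_comp]
  have hval : ∀ f : (opSqrt (opPow a β)).domain,
      (ainv ^ (α / 2) : H →L[ℂ] H) (c (opSqrt (opPow a β) f)) = f := fun f => by
    rw [hfac, hiβ.left_inv]
  -- `hval` exhibits `f` in the range of `b^{α/2}`, which is contained in `D(a^{α/2})`.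
  have hD : (opSqrt (opPow a β)).domain ≤ (opSqrt (opPow a α)).domain := by
    intro f hf
    have := (hiα.right_inv (c (opSqrt (opPow a β) ⟨f, hf⟩))).1
    rwa [hval] at this
  have hinc : ∀ f, opSqrt (opPow a α) (Submodule.inclusion hD f) = c (opSqrt (opPow a β) f) := by
    intro f
    -- Under the injective `b^{α/2}` both sides become `f`.
    apply hiα.injective
    rw [hval, hiα.left_inv, Submodule.coe_inclusion]
  have hfα : Function.Injective (form (opPow a α)) := form_injective hiα.exists_apply_eq
  have hfβ : Function.Injective (form (opPow a β)) := form_injective hiβ.exists_apply_eq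
  have hcxM : ∀ x ∈ M, c * x * c ∈ M := fun x hx => mul_mem (mul_mem hcM hx) hcM
  refine ⟨hD, ?_, ?_, ?_⟩
  · intro y hy y' hy' hxx
    obtain ⟨x, -, rfl⟩ := mem_linfty_iff.mp hy
    obtain ⟨x', -, rfl⟩ := mem_linfty_iff.mp hy'
    rw [restrict_form hD hcsa hinc, restrict_form hD hcsa hinc] at hxx
    rw [eq_of_conj_eq hcsa hcinj (hfβ hxx)]
  · intro y hy
    obtain ⟨x, hx, rfl⟩ := mem_linfty_iff.mp hy
    rw [restrict_form hD hcsa hinc]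
    refine ⟨mem_linfty_iff.mpr ⟨_, hcxM x hx, rfl⟩, ?_⟩
    rw [linftyNorm_form hfβ (hcxM x hx), linftyNorm_form hfα hx, hnorm]
    calc ‖c * x * c‖ ≤ ‖c‖ * ‖x‖ * ‖c‖ :=
          (norm_mul_le _ _).trans (by gcongr; exact norm_mul_le _ _)
      _ = ‖c‖ ^ 2 * ‖x‖ := by ring
  · rintro _ ⟨x, hx, hxsa, rfl⟩
    refine ⟨⟨c * x * c, hcxM x hx, ?_, (restrict_form hD hcsa hinc x).symm⟩, ?_⟩
    · simpa [hcsa.star_eq] using hxsa.conjugate c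
    · rw [hnorm]
      exact orderNorm_restrict_le hD hinc x
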